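/- Let $m\ge 0$ be an integer and let $a,b,c_1,\dots,c_m\in\mathbb{C}$ be arbitrary. Let $D=\mathbb{C}\langle y_1,\dots,y_m,\partial_1,\dots,\partial_m\rangle$ be the Weyl algebra ($y_iy_j=y_jy_i$, $\partial_i\partial_j=\partial_j\partial_i$, $\partial_iy_j=y_j\partial_i+\delta_{ij}$). Every $p\in D$ is uniquely a finite sum $p=\sum c_{\alpha\beta}\,y^\alpha\partial^\beta$; for $p\neq0$ its principal symbol is $$\mathrm{in}_{(\mathbf 0,\mathbf 1)}(p)=\sum_{|\beta|=\mathrm{ord}(p)}c_{\alpha\beta}\,y^\alpha\xi^\beta\in\mathbb{C}[y_1,\dots,y_m,\xi_1,\dots,\xi_m],\qquad \mathrm{ord}(p)=\max\{|\beta| : c_{\alpha\beta}\ne0\},$$ and $\mathrm{in}_{(\mathbf 0,\mathbf 1)}(0)=0$. For a left ideal $I$ of $D$, the characteristic ideal $\mathrm{in}_{(\mathbf 0,\mathbf 1)}(I)$ is the ideal of $\mathbb{C}[y,\xi]$ generated by the principal symbols of all elements of $I$. Put $\theta_i=y_i\partial_i$, $\theta=\theta_1+\cdots+\theta_m$, and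 $$\ell'_i=y_i\theta_i(\theta_i-c_i+1)-(\theta-a)(\theta-b),\qquad i=1,\dots,m,$$ and let $I'(m)$ be the left ideal of $D$ generated by $\ell'_1,\dots,\ell'_m$. **Proposition.** The characteristic ideal $\mathrm{in}_{(\mathbf 0,\mathbf 1)}(I'(m))$ is generated by the principal symbols $\mathrm{in}_{(\mathbf 0,\mathbf 1)}(\ell'_i)$, $i=1,\dots,m$. -/

import Mathlib

noncomputable section

namespace Weyl

/-- The defining relations of the Weyl algebra in the free algebra on
`y_1, …, y_m` (`Sum.inl`) and `∂_1, …, ∂_m` (`Sum.inr`). -/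
inductive Rel (m : ℕ) :
    FreeAlgebra ℂ (Fin m ⊕ Fin m) → FreeAlgebra ℂ (Fin m ⊕ Fin m) → Prop
  | y_comm (i j : Fin m) : Rel m
      (FreeAlgebra.ι ℂ (Sum.inl i) * FreeAlgebra.ι ℂ (Sum.inl j))
      (FreeAlgebra.ι ℂ (Sum.inl j) * FreeAlgebra.ι ℂ (Sum.inl i))
  | d_comm (i j : Fin m) : Rel m
      (FreeAlgebra.ι ℂ (Sum.inr i) * FreeAlgebra.ι ℂ (Sum.inr j))
      (FreeAlgebra.ι ℂ (Sum.inr j) * FreeAlgebra.ι ℂ (Sum.inr i))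
  | d_y (i j : Fin m) : Rel m
      (FreeAlgebra.ι ℂ (Sum.inr i) * FreeAlgebra.ι ℂ (Sum.inl j))
      (FreeAlgebra.ι ℂ (Sum.inl j) * FreeAlgebra.ι ℂ (Sum.inr i) + if i = j then 1 else 0)

end Weyl

/-- The Weyl algebra `D = ℂ⟨y_1, …, y_m, ∂_1, …, ∂_m⟩`. -/
def WeylAlgebra (m : ℕ) : Type := RingQuot (Weyl.Rel m)

namespace Weyl

instance (m : ℕ) : Ring (WeylAlgebra m) := inferInstanceAs (Ring (RingQuot (Rel m)))

instance (m : ℕ) : Algebra ℂ (WeylAlgebra m) :=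
  inferInstanceAs (Algebra ℂ (RingQuot (Rel m)))

/-- The quotient map from the free algebra. -/
def mk (m : ℕ) : FreeAlgebra ℂ (Fin m ⊕ Fin m) →ₐ[ℂ] WeylAlgebra m :=
  RingQuot.mkAlgHom ℂ (Rel m)

/-- The variable `y_i`. -/
def y {m : ℕ} (i : Fin m) : WeylAlgebra m := mk m (FreeAlgebra.ι ℂ (Sum.inl i))

/-- The derivation `∂_i = ∂/∂y_i`. -/
def d {m : ℕ} (i : Fin m) : WeylAlgebra m := mk m (FreeAlgebra.ι ℂ (Sum.inr i))

lemma mk_surjective (m : ℕ) : Function.Surjective (mk m) :=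
  RingQuot.mkAlgHom_surjective ℂ (Rel m)

lemma y_mul_y {m : ℕ} (i j : Fin m) : y i * y j = y j * y i := by
  have h := RingQuot.mkAlgHom_rel ℂ (Rel.y_comm (m := m) i j)
  rw [map_mul, map_mul] at h
  exact h

lemma d_mul_d {m : ℕ} (i j : Fin m) : d i * d j = d j * d i := by
  have h := RingQuot.mkAlgHom_rel ℂ (Rel.d_comm (m := m) i j)
  rw [map_mul, map_mul] at h
  exact h

lemma d_mul_y {m : ℕ} (i j : Fin m) :
    d i * y j = y j * d i + if i = j then 1 else 0 := by
  have h : mk m _ = mk m _ := RingQuot.mkAlgHom_rel ℂ (Rel.d_y (m := m) i j)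
  rw [map_mul, map_add, map_mul, apply_ite (mk m), map_one, map_zero] at h
  exact h

/-- The commutative polynomial ring `ℂ[y_1, …, y_m, ξ_1, …, ξ_m]`, where `y_i` is
`X (Sum.inl i)` and `ξ_i` is `X (Sum.inr i)`. -/
abbrev SymbolRing (m : ℕ) : Type := MvPolynomial (Fin m ⊕ Fin m) ℂ

/-- The normally ordered monomial `y^α ∂^β` for the exponent `e = (α, β)`. -/
def normalMonomial {m : ℕ} (e : (Fin m ⊕ Fin m) →₀ ℕ) : WeylAlgebra m :=
  ((List.finRange m).map fun i => y i ^ e (Sum.inl i)).prod *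
    ((List.finRange m).map fun i => d i ^ e (Sum.inr i)).prod

/-- The linear map `∑ c_{αβ} y^α ξ^β ↦ ∑ c_{αβ} y^α ∂^β`. -/
def normalOrder (m : ℕ) : SymbolRing m →ₗ[ℂ] WeylAlgebra m :=
  (MvPolynomial.basisMonomials (Fin m ⊕ Fin m) ℂ).constr ℂ normalMonomial

lemma normalOrder_monomial {m : ℕ} (e : (Fin m ⊕ Fin m) →₀ ℕ) :
    normalOrder m (MvPolynomial.monomial e 1) = normalMonomial e := by
  have h := (MvPolynomial.basisMonomials (Fin m ⊕ Fin m) ℂ).constr_basis ℂ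
    (normalMonomial (m := m)) e
  rwa [MvPolynomial.coe_basisMonomials] at h

lemma prod_map_pow_succ {A : Type*} [Monoid A] {m : ℕ} (g : Fin m → A)
    (hg : ∀ i j, Commute (g i) (g j)) (i : Fin m) (p q : Fin m → ℕ) (hi : q i = p i + 1)
    (hq : ∀ j, j ≠ i → q j = p j) (l : List (Fin m)) (hl : l.Nodup) (hil : i ∈ l) :
    (l.map fun j => g j ^ q j).prod = g i * (l.map fun j => g j ^ p j).prod := by
  induction l with
  | nil => simp at hil
  | cons k l ih =>
    rw [List.nodup_cons] at hl
    simp only [List.map_cons, List.prod_cons]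
    by_cases hk : k = i
    · subst hk
      have : (l.map fun j => g j ^ q j) = l.map fun j => g j ^ p j := by
        apply List.map_congr_left
        intro j hj
        rw [hq j (fun h => hl.1 (h ▸ hj))]
      rw [this, hi, pow_succ', mul_assoc]
    · have hil' : i ∈ l := by
        rcases List.mem_cons.1 hil with h | h
        · exact absurd h.symm hk
        · exact h
      rw [ih hl.2 hil', hq k hk, ← mul_assoc, ← mul_assoc, ((hg k i).pow_left _).eq]

lemma normalMonomial_zero (m : ℕ) : normalMonomial (m := m) 0 = 1 := by
  simp [normalMonomial]

lemma normalMonomial_y {m : ℕ} (e : (Fin m ⊕ Fin m) →₀ ℕ) (i : Fin m) :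
    normalMonomial (Finsupp.single (Sum.inl i) 1 + e) = y i * normalMonomial e := by
  unfold normalMonomial
  rw [prod_map_pow_succ y y_mul_y i (fun j => e (Sum.inl j)) _ (by simp [add_comm])
    (fun j hj => by simp [hj.symm]) _ (List.nodup_finRange m) (List.mem_finRange i)]
  simp [mul_assoc]

lemma normalMonomial_d {m : ℕ} (e : (Fin m ⊕ Fin m) →₀ ℕ) (he : ∀ j, e (Sum.inl j) = 0)
    (i : Fin m) :
    normalMonomial (Finsupp.single (Sum.inr i) 1 + e) = d i * normalMonomial e := by
  have h := prod_map_pow_succ d d_mul_d i (fun j => e (Sum.inr j))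
    (fun j => (Finsupp.single (Sum.inr i) 1 + e : (Fin m ⊕ Fin m) →₀ ℕ) (Sum.inr j)) (by simp [add_comm])
    (fun j hj => by simp [hj.symm]) _ (List.nodup_finRange m) (List.mem_finRange i)
  unfold normalMonomial
  rw [h]
  simp [he]

lemma exponent_induction {m : ℕ} {P : ((Fin m ⊕ Fin m) →₀ ℕ) → Prop} (h0 : P 0)
    (hd : ∀ e i, (∀ j, e (Sum.inl j) = 0) → P e → P (Finsupp.single (Sum.inr i) 1 + e))
    (hy : ∀ e i, P e → P (Finsupp.single (Sum.inl i) 1 + e)) (e : (Fin m ⊕ Fin m) →₀ ℕ) :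
    P e := by
  induction hn : e.degree generalizing e with
  | zero => rw [Finsupp.degree_eq_zero_iff] at hn; exact hn ▸ h0
  | succ n ih =>
    have key : ∀ s, e s ≠ 0 → ∃ e', e = Finsupp.single s 1 + e' ∧ e'.degree = n := by
      intro s hs
      have hle : Finsupp.single s 1 ≤ e := by
        rw [Finsupp.single_le_iff]; omega
      refine ⟨e - Finsupp.single s 1, (add_tsub_cancel_of_le hle).symm, ?_⟩
      have h2 := congrArg Finsupp.degree (add_tsub_cancel_of_le hle)
      rw [map_add, Finsupp.degree_single] at h2
      omega
    by_cases h : ∃ j, e (Sum.inl j) ≠ 0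
    · obtain ⟨j, hj⟩ := h
      obtain ⟨e', rfl, h'⟩ := key _ hj
      exact hy _ _ (ih _ h')
    · push Not at h
      have hne : e ≠ 0 := by rintro rfl; simp at hn
      obtain ⟨s, hs⟩ := Finsupp.ne_iff.1 hne
      rcases s with j | j
      · exact absurd (h j) hs
      · obtain ⟨e', rfl, h'⟩ := key _ hs
        refine hd _ _ (fun k => ?_) (ih _ h')
        simpa using h k

/-- Multiplication by `y_i` (`Sum.inl i`) and `ξ_i + ∂/∂y_i` (`Sum.inr i`) on symbols:
left multiplication by `y_i` and `∂_i` seen on normally ordered expressions. -/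
def symbolOp {m : ℕ} : Fin m ⊕ Fin m → Module.End ℂ (SymbolRing m)
  | Sum.inl i => LinearMap.mulLeft ℂ (MvPolynomial.X (Sum.inl i))
  | Sum.inr i => LinearMap.mulLeft ℂ (MvPolynomial.X (Sum.inr i)) +
      (MvPolynomial.pderiv (Sum.inl i)).toLinearMap

lemma symbolOp_inl {m : ℕ} (i : Fin m) (f : SymbolRing m) :
    symbolOp (Sum.inl i) f = MvPolynomial.X (Sum.inl i) * f := rfl

lemma symbolOp_inr {m : ℕ} (i : Fin m) (f : SymbolRing m) :
    symbolOp (Sum.inr i) f =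
      MvPolynomial.X (Sum.inr i) * f + MvPolynomial.pderiv (Sum.inl i) f := rfl

lemma symbolOp_rel {m : ℕ} ⦃p q : FreeAlgebra ℂ (Fin m ⊕ Fin m)⦄ (h : Rel m p q) :
    FreeAlgebra.lift ℂ (symbolOp (m := m)) p = FreeAlgebra.lift ℂ symbolOp q := by
  induction h with
  | y_comm i j =>
    apply LinearMap.ext; intro f
    simp only [map_mul, FreeAlgebra.lift_ι_apply, Module.End.mul_apply, symbolOp_inl]
    ring
  | d_comm i j =>
    apply LinearMap.ext; intro f
    have hc : MvPolynomial.pderiv (Sum.inl i) (MvPolynomial.pderiv (Sum.inl j) f) =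
        MvPolynomial.pderiv (Sum.inl j) (MvPolynomial.pderiv (Sum.inl i) f) := by
      have : ⁅(MvPolynomial.pderiv (Sum.inl i) :
            Derivation ℂ (SymbolRing m) (SymbolRing m)),
          (MvPolynomial.pderiv (Sum.inl j) :
            Derivation ℂ (SymbolRing m) (SymbolRing m))⁆ = 0 := by
        refine MvPolynomial.derivation_ext fun s => ?_
        rw [Derivation.commutator_apply]
        simp only [MvPolynomial.pderiv_X, Pi.single_apply]
        split_ifs <;> simp
      have h := congrArg (fun D : Derivation ℂ (SymbolRing m) (SymbolRing m) => D f) this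
      simpa [Derivation.commutator_apply, sub_eq_zero] using h
    have hne : ∀ i j : Fin m, (Sum.inr j : Fin m ⊕ Fin m) ≠ Sum.inl i := by simp
    simp only [map_mul, FreeAlgebra.lift_ι_apply, Module.End.mul_apply, symbolOp_inr, map_add,
      Derivation.leibniz, smul_eq_mul, MvPolynomial.pderiv_X_of_ne (hne _ _), hc]
    ring
  | d_y i j =>
    apply LinearMap.ext; intro f
    by_cases hij : i = j
    · subst hij
      simp only [map_mul, map_add, FreeAlgebra.lift_ι_apply, Module.End.mul_apply, symbolOp_inr,
        symbolOp_inl, Derivation.leibniz, smul_eq_mul, MvPolynomial.pderiv_X_self, if_pos,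
        map_one, LinearMap.add_apply, Module.End.one_apply]
      ring
    · have hne : (Sum.inl j : Fin m ⊕ Fin m) ≠ Sum.inl i := by simpa using Ne.symm hij
      simp only [map_mul, map_add, FreeAlgebra.lift_ι_apply, Module.End.mul_apply, symbolOp_inr,
        symbolOp_inl, Derivation.leibniz, smul_eq_mul, MvPolynomial.pderiv_X_of_ne hne,
        if_neg hij, map_zero, LinearMap.add_apply, LinearMap.zero_apply]
      ring

/-- The action of the Weyl algebra on symbols by `symbolOp`. -/
def symbolAction (m : ℕ) : WeylAlgebra m →ₐ[ℂ] Module.End ℂ (SymbolRing m) :=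
  RingQuot.liftAlgHom ℂ ⟨FreeAlgebra.lift ℂ symbolOp, symbolOp_rel⟩

lemma symbolAction_mk {m : ℕ} (s : Fin m ⊕ Fin m) :
    symbolAction m (mk m (FreeAlgebra.ι ℂ s)) = symbolOp s := by
  have h := RingQuot.liftAlgHom_mkAlgHom_apply ℂ (FreeAlgebra.lift ℂ (symbolOp (m := m)))
    symbolOp_rel (FreeAlgebra.ι ℂ s)
  rw [FreeAlgebra.lift_ι_apply] at h
  exact h

lemma monomial_single_add {m : ℕ} (s : Fin m ⊕ Fin m) (e : (Fin m ⊕ Fin m) →₀ ℕ) :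
    (MvPolynomial.monomial (Finsupp.single s 1 + e) 1 : SymbolRing m) =
      MvPolynomial.X s * MvPolynomial.monomial e 1 := by
  rw [MvPolynomial.X, MvPolynomial.monomial_mul, one_mul]

lemma pderiv_y_monomial {m : ℕ} (e : (Fin m ⊕ Fin m) →₀ ℕ) (he : ∀ j, e (Sum.inl j) = 0)
    (i : Fin m) :
    MvPolynomial.pderiv (Sum.inl i) (MvPolynomial.monomial e 1 : SymbolRing m) = 0 := by
  rw [MvPolynomial.pderiv_monomial]; simp [he]

lemma normalOrder_y {m : ℕ} (i : Fin m) (f : SymbolRing m) :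
    normalOrder m (MvPolynomial.X (Sum.inl i) * f) = y i * normalOrder m f := by
  have : normalOrder m ∘ₗ LinearMap.mulLeft ℂ (MvPolynomial.X (Sum.inl i)) =
      LinearMap.mulLeft ℂ (y i) ∘ₗ normalOrder m := by
    refine (MvPolynomial.basisMonomials _ ℂ).ext fun e => ?_
    simp only [MvPolynomial.coe_basisMonomials, LinearMap.comp_apply, LinearMap.mulLeft_apply]
    rw [← monomial_single_add, normalOrder_monomial, normalOrder_monomial, normalMonomial_y]
  exact LinearMap.congr_fun this f

lemma normalOrder_d {m : ℕ} (i : Fin m) (f : SymbolRing m) :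
    normalOrder m (symbolOp (Sum.inr i) f) = d i * normalOrder m f := by
  have : normalOrder m ∘ₗ symbolOp (Sum.inr i) =
      LinearMap.mulLeft ℂ (d i) ∘ₗ normalOrder m := by
    refine (MvPolynomial.basisMonomials _ ℂ).ext fun e => ?_
    simp only [MvPolynomial.coe_basisMonomials, LinearMap.comp_apply, LinearMap.mulLeft_apply]
    have base : ∀ e : (Fin m ⊕ Fin m) →₀ ℕ, (∀ j, e (Sum.inl j) = 0) →
        normalOrder m (symbolOp (Sum.inr i) (MvPolynomial.monomial e 1)) =
          d i * normalOrder m (MvPolynomial.monomial e 1) := by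
      intro e he
      rw [symbolOp_inr, pderiv_y_monomial e he, add_zero, ← monomial_single_add, normalOrder_monomial,
        normalOrder_monomial, normalMonomial_d e he]
    induction e using exponent_induction with
    | h0 => exact base 0 (by simp)
    | hd e k he _ => exact base _ (by simpa using he)
    | hy e k ih =>
      have h1 : symbolOp (Sum.inr i)
            (MvPolynomial.monomial (Finsupp.single (Sum.inl k) 1 + e) 1) =
          MvPolynomial.X (Sum.inl k) * symbolOp (Sum.inr i) (MvPolynomial.monomial e 1) +
            (if i = k then MvPolynomial.monomial e 1 else 0 : SymbolRing m) := by
        rw [monomial_single_add]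
        simp only [symbolOp_inr, Derivation.leibniz, smul_eq_mul]
        by_cases hik : i = k
        · subst hik
          rw [MvPolynomial.pderiv_X_self, if_pos rfl]; ring
        · rw [MvPolynomial.pderiv_X_of_ne (by simpa using Ne.symm hik), if_neg hik]; ring
      rw [h1, map_add, normalOrder_y, ih, monomial_single_add, normalOrder_y, ← mul_assoc,
        ← mul_assoc, d_mul_y, add_mul]
      congr 1
      by_cases hik : i = k <;> simp [hik]
  exact LinearMap.congr_fun this f

lemma normalOrder_symbolAction {m : ℕ} (p : WeylAlgebra m) :
    ∀ f : SymbolRing m, normalOrder m (symbolAction m p f) = p * normalOrder m f := by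
  obtain ⟨p, rfl⟩ := mk_surjective m p
  induction p using FreeAlgebra.induction with
  | grade0 r =>
    intro f
    rw [AlgHom.commutes, AlgHom.commutes, Module.algebraMap_end_apply, map_smul,
      Algebra.smul_def]
  | grade1 s =>
    intro f
    rw [symbolAction_mk]
    rcases s with i | i
    · exact normalOrder_y i f
    · exact normalOrder_d i f
  | mul p q hp hq => intro f; simp [hp, hq, mul_assoc]
  | add p q hp hq => intro f; simp [hp, hq, add_mul]

lemma normalOrder_one (m : ℕ) : normalOrder m 1 = 1 := by
  have h := normalOrder_monomial (m := m) 0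
  rwa [normalMonomial_zero] at h

lemma symbolAction_normalOrder {m : ℕ} (f : SymbolRing m) :
    symbolAction m (normalOrder m f) 1 = f := by
  have : (LinearMap.applyₗ (1 : SymbolRing m)) ∘ₗ (symbolAction m).toLinearMap ∘ₗ normalOrder m =
      LinearMap.id := by
    refine (MvPolynomial.basisMonomials _ ℂ).ext fun e => ?_
    simp only [MvPolynomial.coe_basisMonomials, LinearMap.comp_apply, LinearMap.id_apply,
      AlgHom.toLinearMap_apply, LinearMap.applyₗ_apply_apply]
    rw [normalOrder_monomial]
    induction e using exponent_induction with
    | h0 => rw [normalMonomial_zero, map_one (symbolAction m)]; rfl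
    | hd e k he ih =>
      rw [normalMonomial_d e he, map_mul, Module.End.mul_apply, ih, d, symbolAction_mk,
        monomial_single_add]
      rw [symbolOp_inr, pderiv_y_monomial e he, add_zero]
    | hy e k ih =>
      rw [normalMonomial_y e, map_mul, Module.End.mul_apply, ih, y, symbolAction_mk,
        monomial_single_add]
      rfl
  exact LinearMap.congr_fun this f

/-- The `y^α ∂^β` form a `ℂ`-basis of `D`. -/
lemma normalOrder_bijective (m : ℕ) : Function.Bijective (normalOrder m) := by
  refine ⟨fun f g h => ?_, fun p => ⟨symbolAction m p 1, ?_⟩⟩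
  · rw [← symbolAction_normalOrder f, h, symbolAction_normalOrder g]
  · rw [normalOrder_symbolAction, normalOrder_one, mul_one]

/-- The full symbol `∑ c_{αβ} y^α ξ^β` of `p = ∑ c_{αβ} y^α ∂^β`. -/
def fullSymbol (m : ℕ) : WeylAlgebra m ≃ₗ[ℂ] SymbolRing m :=
  (LinearEquiv.ofBijective (normalOrder m) (normalOrder_bijective m)).symm

/-- The weight vector `(0, 1)`: each `y_i` has weight `0`, each `ξ_i` has weight `1`. -/
def orderWeight (m : ℕ) : Fin m ⊕ Fin m → ℕ := Sum.elim (fun _ => 0) (fun _ => 1)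

/-- The order `ord_{(0,1)}(p)` of a differential operator. -/
def order {m : ℕ} (p : WeylAlgebra m) : ℕ :=
  MvPolynomial.weightedTotalDegree (orderWeight m) (fullSymbol m p)

/-- The principal symbol `in_{(0,1)}(p)`: the sum of the terms of highest `(0,1)`-weight of the
full symbol. -/
def principalSymbol {m : ℕ} (p : WeylAlgebra m) : SymbolRing m :=
  MvPolynomial.weightedHomogeneousComponent (orderWeight m) (order p) (fullSymbol m p)

/-- The characteristic ideal `in_{(0,1)}(I)` of a left ideal `I` of `D`
(`Ideal` of a noncommutative ring means left ideal). -/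
def characteristicIdeal {m : ℕ} (I : Ideal (WeylAlgebra m)) : Ideal (SymbolRing m) :=
  Ideal.span {f | ∃ p ∈ I, f = principalSymbol p}

/-- The Euler operator `θ_i = y_i ∂_i`. -/
def theta {m : ℕ} (i : Fin m) : WeylAlgebra m := y i * d i

/-- `θ = θ_1 + ⋯ + θ_m`. -/
def thetaSum (m : ℕ) : WeylAlgebra m := ∑ i, theta i

/-- `ℓ'_i = y_i θ_i (θ_i - c_i + 1) - (θ - a) (θ - b)`. -/
def ell' {m : ℕ} (a b : ℂ) (c : Fin m → ℂ) (i : Fin m) : WeylAlgebra m :=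
  y i * theta i * (theta i - algebraMap ℂ _ (c i) + 1) -
    (thetaSum m - algebraMap ℂ _ a) * (thetaSum m - algebraMap ℂ _ b)

/-- The left ideal `I'(m)` generated by `ℓ'_1, …, ℓ'_m`. -/
def idealI' {m : ℕ} (a b : ℂ) (c : Fin m → ℂ) : Ideal (WeylAlgebra m) :=
  Ideal.span (Set.range (ell' a b c))

end Weyl

end

/-!
The operators `ℓ'_i` behave like a Gröbner basis with pairwise coprime leading terms, and the
argument is the corresponding lifting of syzygies, in two steps.

On the commutative side, `σ_i = in_{(0,1)}(ℓ'_i) = y_i³ ξ_i² - (∑ y_j ξ_j)²` has `y_i³ ξ_i²` as its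
form of highest degree in the variables `y` (degree three against two). These monomials are pairwise
coprime, so every relation `∑ f_i y_i³ ξ_i² = 0` is a combination of the trivial (Koszul) ones;
a descent on the `y`-degree (`KoszulSyzygies.of_hasTop`) carries this over to the `σ_i`
(`koszulSyzygies_ellSymbol`).

On the noncommutative side, `θ A_i = A_i (θ + 1)` for `A_i = y_i θ_i (θ_i - c_i + 1)`, and the `A_i`
commute with each other, whence `[ℓ'_i, ℓ'_j] = (2θ - a - b - 1) (ℓ'_i - ℓ'_j)` (`ell'_commutator`).
The factor has order one, so each Koszul relation between the symbols lifts to a relation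
between the `ℓ'_i` with the same symbols. If `p = ∑ q_i ℓ'_i` and the order of some `q_i` exceeds
`ord p - 2`, the symbols of highest order of the `q_i` form a syzygy of the `σ_i`; subtracting its
lift lowers the order of the coefficients (`exists_lower_coefficients`). Once no coefficient
has order above `ord p - 2`, taking symbols shows that `in_{(0,1)}(p)` is a combination of the `σ_i`.
-/

noncomputable section

namespace Weyl

open MvPolynomial

/-! ### Koszul syzygies -/

section Koszul

variable {R ι : Type*} [CommRing R]

lemma sum_antisymm_mul_symm {A : Type*} [Ring A] [IsAddTorsionFree A] [Fintype ι]
    {g h : ι → ι → A} (hg : ∀ i j, g i j = -g j i) (hh : ∀ i j, h i j = h j i) :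
    ∑ i, ∑ j, g i j * h i j = 0 := by
  refine self_eq_neg.1 ?_
  conv_lhs => rw [Finset.sum_comm]
  simp only [← Finset.sum_neg_distrib]
  refine Finset.sum_congr rfl fun i _ => Finset.sum_congr rfl fun j _ => ?_
  rw [hg j i, hh j i, neg_mul]

/-- All syzygies of the family `x` are combinations of the trivial ones `x_j e_i - x_i e_j`;
the combination is recorded as an antisymmetric matrix `g`. -/
def KoszulSyzygies [Fintype ι] (x : ι → R) : Prop :=
  ∀ f : ι → R, ∑ i, f i * x i = 0 →
    ∃ g : ι → ι → R, (∀ i j, g i j = -g j i) ∧ ∀ i, f i = ∑ j, g i j * x j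

/-- If each `x i` is a nonzerodivisor modulo the ideal generated by any finite set of the other
members of the family, then all syzygies are Koszul. -/
lemma exists_koszul_of_regular [DecidableEq ι] (x : ι → R)
    (hreg : ∀ (s : Finset ι) (i : ι), i ∉ s → ∀ r, r * x i ∈ Ideal.span (x '' s) →
      r ∈ Ideal.span (x '' s)) (s : Finset ι) :
    ∀ f : ι → R, ∑ i ∈ s, f i * x i = 0 →
      ∃ g : ι → ι → R, (∀ i j, g i j = -g j i) ∧ ∀ i ∈ s, f i = ∑ j ∈ s, g i j * x j := by
  induction s using Finset.induction_on with
  | empty => exact fun f _ => ⟨fun _ _ => 0, by simp, by simp⟩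
  | insert k s hk ih =>
    intro f hf
    rw [Finset.sum_insert hk] at hf
    -- By regularity `f k = ∑ h i * x i`; substituting gives the syzygy `f i + h i * x k` on `s`.
    have hmem : f k * x k ∈ Ideal.span (x '' s) := by
      rw [eq_neg_of_add_eq_zero_left hf]
      exact neg_mem (sum_mem fun i hi =>
        Ideal.mul_mem_left _ _ (Ideal.subset_span (Set.mem_image_of_mem x hi)))
    obtain ⟨h, hh⟩ : ∃ h : ι → R, ∑ i ∈ s, h i * x i = f k := by
      obtain ⟨h, hh⟩ := (Submodule.mem_span_image_finset_iff_exists_fun R).1 (hreg s k hk _ hmem)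
      refine ⟨fun i => if hi : i ∈ s then h ⟨i, hi⟩ else 0, ?_⟩
      rw [← hh, ← Finset.sum_coe_sort]
      simp
    obtain ⟨g, hg, hfg⟩ := ih (fun i => f i + h i * x k) (by
      simp only [add_mul, Finset.sum_add_distrib]
      have : ∑ i ∈ s, h i * x k * x i = f k * x k := by
        rw [← hh, Finset.sum_mul]
        exact Finset.sum_congr rfl fun i _ => by ring
      rw [this, add_comm, hf])
    refine ⟨fun i j => if i = k then (if j = k then 0 else h j)
      else if j = k then -h i else g i j, fun i j => ?_, fun i hi => ?_⟩
    · by_cases hik : i = k <;> by_cases hjk : j = k <;> simp [hik, hjk, hg i j]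
    · rw [Finset.sum_insert hk]
      have hne : ∀ j ∈ s, j ≠ k := fun j hj h => hk (h ▸ hj)
      rcases Finset.mem_insert.1 hi with rfl | hi
      · rw [← hh]
        simp only [if_true, zero_mul, zero_add]
        exact Finset.sum_congr rfl fun j hj => by rw [if_neg (hne j hj)]
      · simp only [if_neg (hne i hi), if_true]
        rw [Finset.sum_congr rfl fun j hj => by rw [if_neg (hne j hj)], ← hfg i hi]
        ring

end Koszul

/-! ### Forms of highest weight -/

section TopForm

variable {σ : Type*}

/-- Polynomials all of whose monomials have weight less than `n`. With a strict bound,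
`weightLT w 0` is zero. -/
def weightLT (w : σ → ℕ) (n : ℕ) : Submodule ℂ (MvPolynomial σ ℂ) :=
  restrictSupport ℂ {e | Finsupp.weight w e < n}

variable {w : σ → ℕ} {f g f₀ g₀ : MvPolynomial σ ℂ} {n k : ℕ}

lemma mem_weightLT : f ∈ weightLT w n ↔ ∀ e, coeff e f ≠ 0 → Finsupp.weight w e < n := by
  simp [weightLT, mem_restrictSupport_iff, Set.subset_def]

lemma weightLT_mono (h : n ≤ k) : weightLT w n ≤ weightLT w k :=
  fun _ hf => mem_weightLT.2 fun e he => (mem_weightLT.1 hf e he).trans_le h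

lemma eq_zero_of_mem_weightLT_zero (h : f ∈ weightLT w 0) : f = 0 := by
  ext e
  by_contra he
  exact absurd (mem_weightLT.1 h e he) (Nat.not_lt_zero _)

lemma exists_mem_weightLT (w : σ → ℕ) (f : MvPolynomial σ ℂ) : ∃ n, f ∈ weightLT w n :=
  ⟨weightedTotalDegree w f + 1, mem_weightLT.2 fun _ he =>
    Nat.lt_succ_of_le (le_weightedTotalDegree w (mem_support_iff.2 he))⟩

lemma mul_mem_weightLT (hf : f ∈ weightLT w n) (hg : g ∈ weightLT w k) :
    f * g ∈ weightLT w (n + k - 1) := by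
  classical
  refine mem_weightLT.2 fun e he => ?_
  rw [coeff_mul] at he
  obtain ⟨x, hx, hne⟩ := Finset.exists_ne_zero_of_sum_ne_zero he
  have h1 := mem_weightLT.1 hf x.1 (left_ne_zero_of_mul hne)
  have h2 := mem_weightLT.1 hg x.2 (right_ne_zero_of_mul hne)
  rw [← Finset.HasAntidiagonal.mem_antidiagonal.1 hx, map_add]
  omega

lemma IsWeightedHomogeneous.mem_weightLT (h : IsWeightedHomogeneous w f n) :
    f ∈ weightLT w (n + 1) :=
  Weyl.mem_weightLT.2 fun _ he => (h he).trans_lt n.lt_succ_self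

lemma IsWeightedHomogeneous.eq_zero_of_mem_weightLT (h : IsWeightedHomogeneous w f n)
    (h' : f ∈ weightLT w n) : f = 0 := by
  ext e
  by_contra he
  exact (Weyl.mem_weightLT.1 h' e he).ne (h he)

lemma sub_component_mem_weightLT (h : f ∈ weightLT w (n + 1)) :
    f - weightedHomogeneousComponent w n f ∈ weightLT w n := by
  refine mem_weightLT.2 fun e he => ?_
  rw [coeff_sub, coeff_weightedHomogeneousComponent] at he
  split_ifs at he with hw
  · simp at he
  · have := mem_weightLT.1 h e (by simpa using he)
    omega

/-- `f₀` is homogeneous of weight `n` and is the part of weight `n` of `f`, which has no terms of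
weight greater than `n`. The form `f₀` may be zero, so `n` is only an upper bound for the weight
of `f`. -/
structure HasTop (w : σ → ℕ) (n : ℕ) (f f₀ : MvPolynomial σ ℂ) : Prop where
  homogeneous : IsWeightedHomogeneous w f₀ n
  sub_mem : f - f₀ ∈ weightLT w n

namespace HasTop

lemma of_homogeneous (h : IsWeightedHomogeneous w f n) : HasTop w n f f :=
  ⟨h, by simp⟩

lemma of_mem_weightLT (h : f ∈ weightLT w n) : HasTop w n f 0 :=
  ⟨isWeightedHomogeneous_zero _ _ _, by simpa using h⟩

lemma component (h : f ∈ weightLT w (n + 1)) :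
    HasTop w n f (weightedHomogeneousComponent w n f) :=
  ⟨weightedHomogeneousComponent_isWeightedHomogeneous n f, sub_component_mem_weightLT h⟩

lemma mem_weightLT_of_zero (h : HasTop w n f 0) : f ∈ weightLT w n := by
  simpa using h.sub_mem

lemma mem_weightLT_succ (h : HasTop w n f f₀) : f ∈ weightLT w (n + 1) := by
  have := add_mem (weightLT_mono n.le_succ h.sub_mem) (IsWeightedHomogeneous.mem_weightLT h.homogeneous)
  simpa using this

lemma unique (h : HasTop w n f f₀) (h' : HasTop w n f g₀) : f₀ = g₀ := by
  have := _root_.sub_mem h'.sub_mem h.sub_mem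
  rw [sub_sub_sub_cancel_left] at this
  exact sub_eq_zero.1 (IsWeightedHomogeneous.eq_zero_of_mem_weightLT
    (h.homogeneous.sub h'.homogeneous) this)

lemma add (h : HasTop w n f f₀) (h' : HasTop w n g g₀) : HasTop w n (f + g) (f₀ + g₀) :=
  ⟨h.homogeneous.add h'.homogeneous, by
    rw [add_sub_add_comm]; exact add_mem h.sub_mem h'.sub_mem⟩

lemma sub (h : HasTop w n f f₀) (h' : HasTop w n g g₀) : HasTop w n (f - g) (f₀ - g₀) :=
  ⟨h.homogeneous.sub h'.homogeneous, by
    rw [sub_sub_sub_comm]; exact _root_.sub_mem h.sub_mem h'.sub_mem⟩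

lemma sum {ι : Type*} {s : Finset ι} {F F₀ : ι → MvPolynomial σ ℂ}
    (h : ∀ i ∈ s, HasTop w n (F i) (F₀ i)) : HasTop w n (∑ i ∈ s, F i) (∑ i ∈ s, F₀ i) :=
  ⟨.sum s F₀ n fun i hi => (h i hi).homogeneous, by
    rw [← Finset.sum_sub_distrib]; exact sum_mem fun i hi => (h i hi).sub_mem⟩

lemma mul (h : HasTop w n f f₀) (h' : HasTop w k g g₀) : HasTop w (n + k) (f * g) (f₀ * g₀) := by
  refine ⟨h.homogeneous.mul h'.homogeneous, ?_⟩
  have h1 := mul_mem_weightLT h.sub_mem h'.mem_weightLT_succ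
  have h2 := mul_mem_weightLT (IsWeightedHomogeneous.mem_weightLT h.homogeneous) h'.sub_mem
  have := add_mem (weightLT_mono (by omega : _ ≤ n + k) h1) (weightLT_mono (by omega) h2)
  convert this using 1
  ring

lemma weightedTotalDegree_eq (h : HasTop w n f f₀) (hne : f₀ ≠ 0) : weightedTotalDegree w f = n := by
  apply le_antisymm
  · exact Finset.sup_le fun e he =>
      Nat.le_of_lt_succ (mem_weightLT.1 h.mem_weightLT_succ e (mem_support_iff.1 he))
  · obtain ⟨e, he⟩ := exists_coeff_ne_zero hne
    have hwe := h.homogeneous he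
    rw [← hwe]
    apply le_weightedTotalDegree
    rw [mem_support_iff]
    intro h0
    have := mem_weightLT.1 h.sub_mem e (by simpa [h0] using he)
    omega

end HasTop

lemma component_mul_of_homogeneous (hg : IsWeightedHomogeneous w g k) (f : MvPolynomial σ ℂ)
    (n : ℕ) : weightedHomogeneousComponent w (n + k) (f * g) =
      weightedHomogeneousComponent w n f * g := by
  induction f using MvPolynomial.induction_on' with
  | add p q hp hq => rw [add_mul, map_add, hp, hq, map_add, add_mul]
  | monomial e r =>
    have he : IsWeightedHomogeneous w (monomial e r) (Finsupp.weight w e) :=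
      isWeightedHomogeneous_monomial _ _ _ rfl
    rw [weightedHomogeneousComponent_of_mem (he.mul hg), weightedHomogeneousComponent_of_mem he]
    simp only [add_left_inj, ite_mul, zero_mul]

lemma component_mul_of_lt (hg : IsWeightedHomogeneous w g k) (f : MvPolynomial σ ℂ)
    (h : n < k) : weightedHomogeneousComponent w n (f * g) = 0 := by
  induction f using MvPolynomial.induction_on' with
  | add p q hp hq => rw [add_mul, map_add, hp, hq, add_zero]
  | monomial e r =>
    have he : IsWeightedHomogeneous w (monomial e r) (Finsupp.weight w e) :=
      isWeightedHomogeneous_monomial _ _ _ rfl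
    exact (he.mul hg).weightedHomogeneousComponent_ne _ (by omega)

/-- A homogeneous Koszul syzygy is zero, or is given by an antisymmetric matrix of homogeneous
polynomials of complementary weight. -/
lemma KoszulSyzygies.exists_homogeneous {ι : Type*} [Fintype ι] {x f : ι → MvPolynomial σ ℂ}
    (hK : KoszulSyzygies x) (hx : ∀ i, IsWeightedHomogeneous w (x i) k)
    (hf : ∀ i, IsWeightedHomogeneous w (f i) n) (h0 : ∑ i, f i * x i = 0) :
    (∀ i, f i = 0) ∨ ∃ d, n = d + k ∧ ∃ g : ι → ι → MvPolynomial σ ℂ,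
      (∀ i j, IsWeightedHomogeneous w (g i j) d) ∧ (∀ i j, g i j = -g j i) ∧
        ∀ i, f i = ∑ j, g i j * x j := by
  obtain ⟨g, hg, hfg⟩ := hK f h0
  have hf' i : f i = ∑ j, weightedHomogeneousComponent w n (g i j * x j) := by
    rw [← map_sum, ← hfg, (hf i).weightedHomogeneousComponent_same]
  rcases lt_or_ge n k with h | h
  · left
    intro i
    rw [hf' i]
    exact Finset.sum_eq_zero fun j _ => component_mul_of_lt (hx j) _ h
  · obtain ⟨d, rfl⟩ := Nat.exists_eq_add_of_le' h
    refine Or.inr ⟨d, rfl, fun i j => weightedHomogeneousComponent w d (g i j),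
      fun i j => weightedHomogeneousComponent_isWeightedHomogeneous _ _,
      fun i j => by simp only [hg i j, map_neg], fun i => ?_⟩
    rw [hf' i]
    exact Finset.sum_congr rfl fun j _ => component_mul_of_homogeneous (hx j) _ _

/-- If the forms of highest weight of a family have only Koszul syzygies, then so has the family:
subtracting Koszul syzygies lowers the weight of the coefficients of a given syzygy. -/
lemma KoszulSyzygies.of_hasTop {ι : Type*} [Fintype ι] {x x₀ : ι → MvPolynomial σ ℂ}
    (hx : ∀ i, HasTop w k (x i) (x₀ i)) (hK : KoszulSyzygies x₀) : KoszulSyzygies x := by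
  suffices H : ∀ n, ∀ f : ι → MvPolynomial σ ℂ, (∀ i, f i ∈ weightLT w n) →
      ∑ i, f i * x i = 0 →
      ∃ g : ι → ι → MvPolynomial σ ℂ, (∀ i j, g i j = -g j i) ∧ ∀ i, f i = ∑ j, g i j * x j by
    intro f hf
    choose n hn using fun i => exists_mem_weightLT w (f i)
    exact H (∑ i, n i) f (fun i => weightLT_mono
      (Finset.single_le_sum (fun _ _ => Nat.zero_le _) (Finset.mem_univ i)) (hn i)) hf
  intro n
  induction n with
  | zero =>
    intro f hf _
    exact ⟨fun _ _ => 0, by simp, fun i => by simpa using eq_zero_of_mem_weightLT_zero (hf i)⟩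
  | succ n ih =>
    intro f hf h0
    have htop i := HasTop.component (hf i)
    have hz : ∑ i, weightedHomogeneousComponent w n (f i) * x₀ i = 0 := by
      refine (HasTop.sum fun i (_ : i ∈ Finset.univ) => (htop i).mul (hx i)).unique ?_
      rw [h0]
      exact .of_homogeneous (isWeightedHomogeneous_zero _ _ _)
    rcases hK.exists_homogeneous (fun i => (hx i).homogeneous)
      (fun i => (htop i).homogeneous) hz with h | ⟨d, rfl, g, hgd, hg, hfg⟩
    · exact ih f (fun i => (h i ▸ htop i).mem_weightLT_of_zero) h0
    · obtain ⟨g', hg', hfg'⟩ := ih (fun i => f i - ∑ j, g i j * x j) (fun i => by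
        refine HasTop.mem_weightLT_of_zero ?_
        have := (htop i).sub (HasTop.sum fun j (_ : j ∈ Finset.univ) =>
          (HasTop.of_homogeneous (hgd i j)).mul (hx j))
        rwa [hfg i, sub_self] at this) (by
        have hz' : ∑ i, ∑ j, g i j * (x j * x i) = 0 :=
          sum_antisymm_mul_symm hg fun i j => mul_comm _ _
        simp only [sub_mul, Finset.sum_sub_distrib, h0, Finset.sum_mul, mul_assoc, hz', sub_zero])
      exact ⟨fun i j => g i j + g' i j, fun i j => by simp only [hg i j, hg' i j]; ring, fun i => by
        simp only [add_mul, Finset.sum_add_distrib, ← hfg' i]; ring⟩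

end TopForm

/-! ### Symbols of products in the Weyl algebra -/

section Symbol

variable {m : ℕ}

lemma fullSymbol_normalOrder (f : SymbolRing m) : fullSymbol m (normalOrder m f) = f :=
  (LinearEquiv.ofBijective (normalOrder m) (normalOrder_bijective m)).symm_apply_apply f

lemma normalOrder_fullSymbol (p : WeylAlgebra m) : normalOrder m (fullSymbol m p) = p :=
  (LinearEquiv.ofBijective (normalOrder m) (normalOrder_bijective m)).apply_symm_apply p

lemma fullSymbol_mul (p q : WeylAlgebra m) :
    fullSymbol m (p * q) = symbolAction m p (fullSymbol m q) := by
  apply (normalOrder_bijective m).1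
  rw [normalOrder_fullSymbol, normalOrder_symbolAction, normalOrder_fullSymbol]

lemma pderiv_y_mem_weightLT {f : SymbolRing m} {n : ℕ} (i : Fin m)
    (hf : f ∈ weightLT (orderWeight m) n) :
    pderiv (Sum.inl i) f ∈ weightLT (orderWeight m) n := by
  classical
  rw [f.as_sum, map_sum]
  refine sum_mem fun e he => mem_weightLT.2 fun e' he' => ?_
  rw [pderiv_monomial, coeff_monomial] at he'
  split_ifs at he' with h
  · have h1 := mem_weightLT.1 hf e (mem_support_iff.1 he)
    have h2 := congrArg (Finsupp.weight (orderWeight m))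
      (add_tsub_cancel_of_le (tsub_le_self : e - Finsupp.single (Sum.inl i) 1 ≤ e))
    rw [map_add, h] at h2
    omega
  · exact absurd rfl he'

lemma X_mem_weightLT {σ : Type*} (w : σ → ℕ) (s : σ) :
    (X s : MvPolynomial σ ℂ) ∈ weightLT w (w s + 1) :=
  IsWeightedHomogeneous.mem_weightLT (isWeightedHomogeneous_X ℂ w s)

/-- Left multiplication by `y^α ∂^β` agrees with multiplication by `y^α ξ^β` on symbols up to terms
of lower order. -/
lemma symbolAction_normalMonomial_sub_mem (e : (Fin m ⊕ Fin m) →₀ ℕ) {f : SymbolRing m} {k : ℕ}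
    (hf : f ∈ weightLT (orderWeight m) (k + 1)) :
    symbolAction m (normalMonomial e) f - monomial e 1 * f ∈
      weightLT (orderWeight m) (Finsupp.weight (orderWeight m) e + k) := by
  induction e using exponent_induction with
  | h0 => rw [normalMonomial_zero, map_one (symbolAction m)]; simp
  | hd e i he ih =>
    rw [normalMonomial_d e he, map_mul, Module.End.mul_apply, d, symbolAction_mk, symbolOp_inr,
      monomial_single_add]
    set g := symbolAction m (normalMonomial e) f
    have hmon : (monomial e 1 : SymbolRing m) ∈
        weightLT (orderWeight m) (Finsupp.weight (orderWeight m) e + 1) :=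
      IsWeightedHomogeneous.mem_weightLT (isWeightedHomogeneous_monomial _ _ _ rfl)
    have hgm : g ∈ weightLT (orderWeight m) (Finsupp.weight (orderWeight m) e + k + 1) := by
      have := add_mem (weightLT_mono (Nat.le_succ _) ih)
        (weightLT_mono (by omega) (mul_mem_weightLT hmon hf))
      simpa using this
    have h1 := mul_mem_weightLT (X_mem_weightLT (orderWeight m) (Sum.inr i)) ih
    have h2 := add_mem (weightLT_mono (by simp [orderWeight]; omega) h1)
      (pderiv_y_mem_weightLT i hgm)
    have hw : Finsupp.weight (orderWeight m) (Finsupp.single (Sum.inr i) 1 + e) + k =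
        Finsupp.weight (orderWeight m) e + k + 1 := by
      simp [orderWeight, Finsupp.weight_single]; omega
    rw [hw]
    convert h2 using 1
    ring
  | hy e i ih =>
    rw [normalMonomial_y, map_mul, Module.End.mul_apply, y, symbolAction_mk, symbolOp_inl,
      monomial_single_add]
    have h1 := mul_mem_weightLT (X_mem_weightLT (orderWeight m) (Sum.inl i)) ih
    have hw : Finsupp.weight (orderWeight m) (Finsupp.single (Sum.inl i) 1 + e) + k =
        orderWeight m (Sum.inl i) + 1 + (Finsupp.weight (orderWeight m) e + k) - 1 := by
      simp [orderWeight, Finsupp.weight_single]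
    rw [hw]
    convert h1 using 1
    ring

/-- The associated graded ring of the order filtration is commutative: full symbols are
multiplicative up to terms of lower order. -/
lemma fullSymbol_mul_sub_mem {p q : WeylAlgebra m} {n k : ℕ}
    (hp : fullSymbol m p ∈ weightLT (orderWeight m) (n + 1))
    (hq : fullSymbol m q ∈ weightLT (orderWeight m) (k + 1)) :
    fullSymbol m (p * q) - fullSymbol m p * fullSymbol m q ∈
      weightLT (orderWeight m) (n + k) := by
  have hsum : p = ∑ e ∈ (fullSymbol m p).support,
      coeff e (fullSymbol m p) • normalMonomial e := by
    conv_lhs => rw [← normalOrder_fullSymbol p, (fullSymbol m p).as_sum, map_sum]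
    refine Finset.sum_congr rfl fun e _ => ?_
    rw [← normalOrder_monomial, ← map_smul, smul_monomial, smul_eq_mul, mul_one]
  have h1 : fullSymbol m (p * q) = ∑ e ∈ (fullSymbol m p).support,
      coeff e (fullSymbol m p) • symbolAction m (normalMonomial e) (fullSymbol m q) := by
    conv_lhs => rw [fullSymbol_mul, hsum]
    simp
  have h2 : fullSymbol m p * fullSymbol m q = ∑ e ∈ (fullSymbol m p).support,
      coeff e (fullSymbol m p) • (monomial e 1 * fullSymbol m q) := by
    conv_lhs => rw [(fullSymbol m p).as_sum, Finset.sum_mul]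
    refine Finset.sum_congr rfl fun e _ => ?_
    rw [← smul_mul_assoc, smul_monomial, smul_eq_mul, mul_one]
  rw [h1, h2, ← Finset.sum_sub_distrib]
  refine sum_mem fun e he => ?_
  rw [← smul_sub]
  have := mem_weightLT.1 hp e (mem_support_iff.1 he)
  exact Submodule.smul_mem _ _
    (weightLT_mono (by omega) (symbolAction_normalMonomial_sub_mem e hq))

/-- `p` has order at most `n`, and `f` is the part of order `n` of its full symbol. It is the
principal symbol of `p` unless `f = 0`. -/
def HasSymbol (n : ℕ) (p : WeylAlgebra m) (f : SymbolRing m) : Prop :=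
  HasTop (orderWeight m) n (fullSymbol m p) f

namespace HasSymbol

variable {n k : ℕ} {p q : WeylAlgebra m} {f g : SymbolRing m}

lemma add (h : HasSymbol n p f) (h' : HasSymbol n q g) : HasSymbol n (p + q) (f + g) := by
  unfold HasSymbol; rw [map_add]; exact HasTop.add h h'

lemma sub (h : HasSymbol n p f) (h' : HasSymbol n q g) : HasSymbol n (p - q) (f - g) := by
  unfold HasSymbol; rw [map_sub]; exact HasTop.sub h h'

lemma sum {ι : Type*} {s : Finset ι} {P : ι → WeylAlgebra m} {F : ι → SymbolRing m}
    (h : ∀ i ∈ s, HasSymbol n (P i) (F i)) : HasSymbol n (∑ i ∈ s, P i) (∑ i ∈ s, F i) := by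
  unfold HasSymbol; rw [map_sum]; exact HasTop.sum h

lemma mul (h : HasSymbol n p f) (h' : HasSymbol k q g) : HasSymbol (n + k) (p * q) (f * g) := by
  have h1 := HasTop.mul h h'
  refine ⟨h1.homogeneous, ?_⟩
  have := add_mem h1.sub_mem
    (fullSymbol_mul_sub_mem h.mem_weightLT_succ h'.mem_weightLT_succ)
  convert this using 1
  ring

lemma of_mem_weightLT (h : fullSymbol m p ∈ weightLT (orderWeight m) n) : HasSymbol n p 0 :=
  HasTop.of_mem_weightLT h

/-- An operator of order at most `n` has zero symbol in order `n + 1`. -/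
lemma succ (h : HasSymbol n p f) : HasSymbol (n + 1) p 0 :=
  of_mem_weightLT (HasTop.mem_weightLT_succ h)

lemma normalOrder (h : IsWeightedHomogeneous (orderWeight m) f n) :
    HasSymbol n (Weyl.normalOrder m f) f := by
  unfold HasSymbol; rw [fullSymbol_normalOrder]; exact HasTop.of_homogeneous h

lemma y (i : Fin m) : HasSymbol 0 (Weyl.y i) (X (Sum.inl i)) := by
  have h := normalOrder (m := m) (isWeightedHomogeneous_X ℂ (orderWeight m) (Sum.inl i))
  have h2 : Weyl.normalOrder m (X (Sum.inl i)) = Weyl.y i := by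
    have := normalOrder_y (m := m) i 1
    rwa [mul_one, normalOrder_one, mul_one] at this
  rwa [h2] at h

lemma d (i : Fin m) : HasSymbol 1 (Weyl.d i) (X (Sum.inr i)) := by
  have h := normalOrder (m := m) (isWeightedHomogeneous_X ℂ (orderWeight m) (Sum.inr i))
  have h2 : Weyl.normalOrder m (X (Sum.inr i)) = Weyl.d i := by
    have := normalOrder_d (m := m) i 1
    rwa [symbolOp_inr, mul_one, normalOrder_one, mul_one, pderiv_one, add_zero] at this
  rwa [h2] at h

lemma one : HasSymbol (m := m) 0 1 1 := by
  have h := normalOrder (m := m) (isWeightedHomogeneous_one ℂ (orderWeight m))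
  rwa [normalOrder_one] at h

lemma scalar (r : ℂ) : HasSymbol (m := m) 0 (algebraMap ℂ _ r) (C r) := by
  have h := normalOrder (m := m) (isWeightedHomogeneous_C (orderWeight m) r)
  have h2 : Weyl.normalOrder m (C r) = algebraMap ℂ _ r := by
    rw [C_eq_smul_one, map_smul, normalOrder_one, Algebra.algebraMap_eq_smul_one]
  rwa [h2] at h

lemma principalSymbol_eq (h : HasSymbol n p f) (hf : f ≠ 0) : principalSymbol p = f := by
  have ho : order p = n := HasTop.weightedTotalDegree_eq h hf
  rw [principalSymbol, ho]
  exact (HasTop.component (HasTop.mem_weightLT_succ h)).unique h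

end HasSymbol

lemma fullSymbol_mem_weightLT_order (p : WeylAlgebra m) :
    fullSymbol m p ∈ weightLT (orderWeight m) (order p + 1) :=
  mem_weightLT.2 fun _ he =>
    Nat.lt_succ_of_le (le_weightedTotalDegree _ (mem_support_iff.2 he))

lemma hasSymbol_principalSymbol (p : WeylAlgebra m) : HasSymbol (order p) p (principalSymbol p) :=
  HasTop.component (fullSymbol_mem_weightLT_order p)

end Symbol

/-! ### Commutators of the generators -/

variable {m : ℕ}

section Commutators

lemma theta_mul_y (i j : Fin m) :
    theta i * y j = y j * theta i + if i = j then y j else 0 := by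
  rw [theta, mul_assoc, d_mul_y, mul_add, ← mul_assoc, y_mul_y, mul_assoc]
  by_cases h : i = j <;> simp [h]

lemma d_mul_theta (i j : Fin m) :
    d i * theta j = theta j * d i + if i = j then d j else 0 := by
  rw [theta, ← mul_assoc, d_mul_y, add_mul, mul_assoc, d_mul_d, ← mul_assoc]
  by_cases h : i = j <;> simp [h]

lemma theta_commute (i j : Fin m) : Commute (theta i) (theta j) := by
  change theta i * (y j * d j) = y j * d j * theta i
  rw [← mul_assoc, theta_mul_y, mul_assoc (y j) (d j), d_mul_theta]
  by_cases h : i = j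
  · subst h
    simp [add_mul, mul_add, mul_assoc]
  · simp [h, Ne.symm h, mul_assoc]

lemma y_commute_theta {i j : Fin m} (h : i ≠ j) : Commute (y i) (theta j) := by
  change y i * theta j = theta j * y i
  rw [theta_mul_y, if_neg h.symm, add_zero]

lemma thetaSum_mul_y (i : Fin m) : thetaSum m * y i = y i * (thetaSum m + 1) := by
  simp [thetaSum, Finset.sum_mul, theta_mul_y, Finset.sum_add_distrib, mul_add, Finset.mul_sum]

lemma thetaSum_commute_theta (i : Fin m) : Commute (thetaSum m) (theta i) :=
  Commute.sum_left _ _ _ fun j _ => theta_commute j i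

/-- The part `A_i = y_i θ_i (θ_i - c_i + 1)` of `ℓ'_i`. -/
def cubicPart (c : Fin m → ℂ) (i : Fin m) : WeylAlgebra m :=
  y i * theta i * (theta i - algebraMap ℂ _ (c i) + 1)

lemma commute_cubicFactor {p : WeylAlgebra m} (c : Fin m → ℂ) {i : Fin m}
    (h : Commute p (theta i)) : Commute p (theta i * (theta i - algebraMap ℂ _ (c i) + 1)) :=
  h.mul_right ((h.sub_right (Algebra.commutes (c i) p).symm).add_right (Commute.one_right p))

lemma cubicPart_commute (c : Fin m → ℂ) (i j : Fin m) :
    Commute (cubicPart c i) (cubicPart c j) := by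
  rcases eq_or_ne i j with rfl | h
  · exact Commute.refl _
  · have hyy : Commute (y i) (y j) := y_mul_y i j
    unfold cubicPart
    rw [mul_assoc, mul_assoc]
    exact (hyy.mul_right (commute_cubicFactor c (y_commute_theta h))).mul_left
      ((commute_cubicFactor c (y_commute_theta h.symm)).symm.mul_right
        (commute_cubicFactor c (commute_cubicFactor c (theta_commute j i)).symm))

/-- `A_i` raises the `y`-degree by one. -/
lemma thetaSum_mul_cubicPart (c : Fin m → ℂ) (i : Fin m) :
    thetaSum m * cubicPart c i = cubicPart c i * (thetaSum m + 1) := by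
  have h := commute_cubicFactor c (thetaSum_commute_theta i)
  rw [cubicPart, mul_assoc, ← mul_assoc (thetaSum m), thetaSum_mul_y, mul_assoc, mul_assoc,
    add_mul, h.eq]
  simp only [mul_add, mul_one, one_mul]

lemma ell'_commutator (a b : ℂ) (c : Fin m → ℂ) (i j : Fin m) :
    ell' a b c i * ell' a b c j - ell' a b c j * ell' a b c i =
      (2 * thetaSum m - algebraMap ℂ _ (a + b + 1)) * (ell' a b c i - ell' a b c j) := by
  -- For `B(θ) = (θ - a)(θ - b)`: `[B(θ), A_k] = (B(θ) - B(θ - 1)) A_k = (2θ - a - b - 1) A_k`.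
  have key : ∀ k, (thetaSum m - algebraMap ℂ _ a) * (thetaSum m - algebraMap ℂ _ b) *
      cubicPart c k - cubicPart c k *
        ((thetaSum m - algebraMap ℂ _ a) * (thetaSum m - algebraMap ℂ _ b)) =
      (2 * thetaSum m - algebraMap ℂ _ (a + b + 1)) * cubicPart c k := by
    intro k
    have h := thetaSum_mul_cubicPart c k
    have ha := Algebra.commutes a (cubicPart c k)
    have hb := Algebra.commutes b (cubicPart c k)
    have hab := Algebra.commutes a (thetaSum m)
    have hbb := Algebra.commutes b (thetaSum m)
    simp only [map_add, map_one]
    set t := thetaSum m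
    set A := cubicPart c k
    set α := algebraMap ℂ (WeylAlgebra m) a
    set β := algebraMap ℂ (WeylAlgebra m) b
    have hA : A * t = t * A - A := by rw [h]; noncomm_ring
    have e1 : A * ((t - α) * (t - β)) = (t - 1 - α) * (t - 1 - β) * A := by
      have f1 : A * (t - α) = (t - 1 - α) * A := by
        rw [mul_sub, hA, ← ha]; noncomm_ring
      have f2 : A * (t - β) = (t - 1 - β) * A := by
        rw [mul_sub, hA, ← hb]; noncomm_ring
      rw [← mul_assoc, f1, mul_assoc, f2, mul_assoc]
    rw [e1, ← sub_mul]
    congr 1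
    have : (t - α) * (t - β) - (t - 1 - α) * (t - 1 - β) = t + t - α - β - 1 := by
      noncomm_ring
    rw [this, two_mul]
    noncomm_ring
  have hAA := (cubicPart_commute c i j).eq
  have hi := key i
  have hj := key j
  change (cubicPart c i - _) * (cubicPart c j - _) - (cubicPart c j - _) * (cubicPart c i - _) =
    _ * ((cubicPart c i - _) - (cubicPart c j - _))
  rw [sub_sub_sub_cancel_right, mul_sub (2 * thetaSum m - _), ← hi, ← hj]
  simp only [mul_sub, sub_mul, hAA]
  abel

end Commutators

/-! ### The symbols of the generators and their syzygies -/

section Symbols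

/-- The monomial `y_i³ ξ_i²`. -/
def leadSymbol (i : Fin m) : SymbolRing m :=
  monomial (Finsupp.single (Sum.inl i) 3 + Finsupp.single (Sum.inr i) 2) 1

/-- The symbol `σ_i = y_i³ ξ_i² - (∑ y_j ξ_j)²` of `ℓ'_i`. -/
def ellSymbol (i : Fin m) : SymbolRing m :=
  leadSymbol i - (∑ j, X (Sum.inl j) * X (Sum.inr j)) ^ 2

lemma leadSymbol_eq (i : Fin m) :
    leadSymbol i = X (Sum.inl i) ^ 3 * X (Sum.inr i) ^ 2 := by
  rw [leadSymbol, X_pow_eq_monomial, X_pow_eq_monomial, monomial_mul, one_mul]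

lemma hasSymbol_theta (i : Fin m) :
    HasSymbol 1 (theta i) (X (Sum.inl i) * X (Sum.inr i)) := by
  simpa [theta] using (HasSymbol.y i).mul (HasSymbol.d i)

lemma hasSymbol_thetaSum (m : ℕ) :
    HasSymbol 1 (thetaSum m) (∑ j, X (Sum.inl j) * X (Sum.inr j)) :=
  HasSymbol.sum fun j _ => hasSymbol_theta j

lemma HasSymbol.sub_scalar {p : WeylAlgebra m} {f : SymbolRing m} (h : HasSymbol 1 p f) (r : ℂ) :
    HasSymbol 1 (p - algebraMap ℂ _ r) f := by
  simpa using h.sub (HasSymbol.scalar r).succ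

lemma hasSymbol_ell' (a b : ℂ) (c : Fin m → ℂ) (i : Fin m) :
    HasSymbol 2 (ell' a b c i) (ellSymbol i) := by
  have h1 := ((HasSymbol.y i).mul (hasSymbol_theta i)).mul
    (((hasSymbol_theta i).sub_scalar (c i)).add HasSymbol.one.succ)
  have h2 := ((hasSymbol_thetaSum m).sub_scalar a).mul ((hasSymbol_thetaSum m).sub_scalar b)
  have h := h1.sub h2
  have he : X (Sum.inl i) * (X (Sum.inl i) * X (Sum.inr i)) *
      (X (Sum.inl i) * X (Sum.inr i) + 0) -
      (∑ j, X (Sum.inl j) * X (Sum.inr j)) * (∑ j, X (Sum.inl j) * X (Sum.inr j)) =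
      ellSymbol (m := m) i := by
    rw [ellSymbol, leadSymbol_eq]; ring
  rw [he] at h
  exact h

/-- The weight `(1, 0)`, for the degree in the variables `y`. -/
def yWeight (m : ℕ) : Fin m ⊕ Fin m → ℕ := Sum.elim (fun _ => 1) (fun _ => 0)

lemma hasTop_ellSymbol (i : Fin m) : HasTop (yWeight m) 3 (ellSymbol i) (leadSymbol i) := by
  constructor
  · exact isWeightedHomogeneous_monomial _ _ _ (by simp [yWeight, Finsupp.weight_single])
  · rw [ellSymbol, sub_sub_cancel_left]
    refine neg_mem (IsWeightedHomogeneous.mem_weightLT (n := 2) ?_)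
    exact (IsWeightedHomogeneous.sum Finset.univ _ 1 fun j _ =>
      (isWeightedHomogeneous_X ℂ (yWeight m) (Sum.inl j)).mul
        (isWeightedHomogeneous_X ℂ (yWeight m) (Sum.inr j))).pow 2

lemma ellSymbol_ne_zero (i : Fin m) : ellSymbol i ≠ 0 := by
  intro h
  have h1 := hasTop_ellSymbol i
  rw [h] at h1
  have := h1.unique (.of_homogeneous (isWeightedHomogeneous_zero _ _ _))
  simp [leadSymbol] at this

/-- A monomial is a nonzerodivisor modulo an ideal generated by monomials coprime to it. -/
lemma leadSymbol_regular (s : Finset (Fin m)) (i : Fin m) (hi : i ∉ s) (r : SymbolRing m)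
    (hr : r * leadSymbol i ∈ Ideal.span (leadSymbol '' (s : Set (Fin m)))) :
    r ∈ Ideal.span (leadSymbol '' (s : Set (Fin m))) := by
  classical
  have himg : (leadSymbol '' (s : Set (Fin m))) = (fun e => monomial e (1 : ℂ)) ''
      ((fun j : Fin m => (Finsupp.single (Sum.inl j) 3 + Finsupp.single (Sum.inr j) 2 :
        (Fin m ⊕ Fin m) →₀ ℕ)) '' s) := by
    rw [Set.image_image]; rfl
  rw [himg, mem_ideal_span_monomial_image] at hr ⊢
  intro e he
  obtain ⟨_, ⟨j, hj, rfl⟩, hle⟩ := hr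
    (e + (Finsupp.single (Sum.inl i) 3 + Finsupp.single (Sum.inr i) 2)) (by
      rw [mem_support_iff, leadSymbol, coeff_mul_monomial, mul_one]
      exact mem_support_iff.1 he)
  have hij : i ≠ j := fun h => hi (h ▸ hj)
  refine ⟨_, ⟨j, hj, rfl⟩, fun s => ?_⟩
  have hs := hle s
  rcases s with k | k
  · by_cases hk : j = k
    · subst hk
      simpa [hij] using hs
    · simp [hk]
  · by_cases hk : j = k
    · subst hk
      simpa [hij] using hs
    · simp [hk]

lemma koszulSyzygies_ellSymbol (m : ℕ) : KoszulSyzygies (ellSymbol (m := m)) := by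
  refine KoszulSyzygies.of_hasTop hasTop_ellSymbol fun f hf => ?_
  obtain ⟨g, hg, h⟩ := exists_koszul_of_regular leadSymbol leadSymbol_regular Finset.univ f hf
  exact ⟨g, hg, fun i => h i (Finset.mem_univ i)⟩

end Symbols

/-! ### Lowering the order of the coefficients -/

section Descent

variable (a b : ℂ) (c : Fin m → ℂ)

/-- The lift to the Weyl algebra of the Koszul syzygy of the `σ_i` with matrix `G`. By
`ell'_commutator`, `(ℓ'_j + C) ℓ'_i` is symmetric in `i` and `j`, where `C = 2θ - a - b - 1`. -/
lemma sum_mul_ell'_antisymm (G : Fin m → Fin m → WeylAlgebra m) (hG : ∀ i j, G i j = -G j i) :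
    ∑ i, (∑ j, G i j * (ell' a b c j + (2 * thetaSum m - algebraMap ℂ _ (a + b + 1)))) *
      ell' a b c i = 0 := by
  set C := 2 * thetaSum m - algebraMap ℂ _ (a + b + 1) with hC
  set l := ell' a b c with hl
  have hcomm i j : (l j + C) * l i = (l i + C) * l j := by
    have h := ell'_commutator a b c j i
    rw [← hl, ← hC, mul_sub, sub_eq_sub_iff_add_eq_add] at h
    rw [add_mul, add_mul]
    rw [h, add_comm]
  let : Module ℚ (WeylAlgebra m) := Module.compHom _ (algebraMap ℚ ℂ)
  have : IsAddTorsionFree (WeylAlgebra m) := .of_module_rat _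
  simp only [Finset.sum_mul, mul_assoc]
  exact sum_antisymm_mul_symm hG hcomm

/-- If the order `r` of the coefficients of `p = ∑ q_i ℓ'_i` is so high that the terms of order
`r + 2` cancel, then the order of the coefficients can be lowered. -/
lemma exists_lower_coefficients {n r : ℕ} {p : WeylAlgebra m}
    (hp : fullSymbol m p ∈ weightLT (orderWeight m) n) (hr : n ≤ r + 2)
    (q : Fin m → WeylAlgebra m) (hq : ∀ i, fullSymbol m (q i) ∈ weightLT (orderWeight m) (r + 1))
    (hpq : p = ∑ i, q i * ell' a b c i) :
    ∃ q' : Fin m → WeylAlgebra m, (∀ i, fullSymbol m (q' i) ∈ weightLT (orderWeight m) r) ∧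
      p = ∑ i, q' i * ell' a b c i := by
  have htop i : HasSymbol r (q i) _ := HasTop.component (hq i)
  have hz : ∑ i, weightedHomogeneousComponent (orderWeight m) r (fullSymbol m (q i)) *
      ellSymbol i = 0 := by
    have h1 := HasSymbol.sum fun i (_ : i ∈ Finset.univ) => (htop i).mul (hasSymbol_ell' a b c i)
    rw [← hpq] at h1
    exact HasTop.unique h1 (.of_mem_weightLT (weightLT_mono hr hp))
  rcases (koszulSyzygies_ellSymbol m).exists_homogeneous
    (fun i => (hasSymbol_ell' 0 0 0 i).homogeneous) (fun i => (htop i).homogeneous) hz with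
    h | ⟨d, rfl, g, hgd, hg, hfg⟩
  · exact ⟨q, fun i => (h i ▸ htop i).mem_weightLT_of_zero, hpq⟩
  · set C : WeylAlgebra m := 2 * thetaSum m - algebraMap ℂ _ (a + b + 1) with hC
    have hCs : HasSymbol 2 C 0 := by
      have := ((hasSymbol_thetaSum m).add (hasSymbol_thetaSum m)).sub_scalar (a + b + 1)
      rw [← two_mul] at this
      exact this.succ
    refine ⟨fun i => q i - ∑ j, normalOrder m (g i j) * (ell' a b c j + C), fun i => ?_, ?_⟩
    · have h1 := (htop i).sub (HasSymbol.sum fun j (_ : j ∈ Finset.univ) =>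
        (HasSymbol.normalOrder (hgd i j)).mul ((hasSymbol_ell' a b c j).add hCs))
      rw [hfg i] at h1
      simp only [add_zero, sub_self] at h1
      exact HasTop.mem_weightLT_of_zero h1
    · simp only [sub_mul, Finset.sum_sub_distrib]
      rw [sum_mul_ell'_antisymm a b c _ fun i j => by rw [hg i j, map_neg], sub_zero, hpq]

/-- Truncated subtraction is intended: for `n ≤ 2` the coefficients vanish, that is, the ideal
contains no nonzero operator of order less than two. -/
lemma exists_coefficients_of_mem_idealI' {n : ℕ} {p : WeylAlgebra m} (hpI : p ∈ idealI' a b c)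
    (hp : fullSymbol m p ∈ weightLT (orderWeight m) n) :
    ∃ q : Fin m → WeylAlgebra m, (∀ i, fullSymbol m (q i) ∈ weightLT (orderWeight m) (n - 2)) ∧
      p = ∑ i, q i * ell' a b c i := by
  suffices H : ∀ r, n - 2 ≤ r → (∃ q : Fin m → WeylAlgebra m,
      (∀ i, fullSymbol m (q i) ∈ weightLT (orderWeight m) r) ∧ p = ∑ i, q i * ell' a b c i) →
      ∃ q : Fin m → WeylAlgebra m, (∀ i, fullSymbol m (q i) ∈ weightLT (orderWeight m) (n - 2)) ∧
        p = ∑ i, q i * ell' a b c i by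
    obtain ⟨q, hq⟩ := (Submodule.mem_span_range_iff_exists_fun _).1 hpI
    choose N hN using fun i => exists_mem_weightLT (orderWeight m) (fullSymbol m (q i))
    exact H (n - 2 + ∑ i, N i) (Nat.le_add_right _ _) ⟨q, fun i => weightLT_mono
      ((Finset.single_le_sum (fun _ _ => Nat.zero_le _) (Finset.mem_univ i)).trans
        (Nat.le_add_left _ _)) (hN i), hq.symm⟩
  intro r hr
  induction r, hr using Nat.le_induction with
  | base => exact id
  | succ r hr ih =>
    rintro ⟨q, hq, hpq⟩
    exact ih (exists_lower_coefficients a b c hp (by omega) q hq hpq)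

end Descent

/-! ### The characteristic ideal -/

lemma principalSymbol_ell' (a b : ℂ) (c : Fin m → ℂ) (i : Fin m) :
    principalSymbol (ell' a b c i) = ellSymbol i :=
  (hasSymbol_ell' a b c i).principalSymbol_eq (ellSymbol_ne_zero i)

/-- A representation of `p` without cancellation in the highest order yields one of its principal
symbol. -/
lemma principalSymbol_mem_span (a b : ℂ) (c : Fin m → ℂ) {p : WeylAlgebra m}
    (hp : p ∈ idealI' a b c) :
    principalSymbol p ∈ Ideal.span (Set.range (ellSymbol (m := m))) := by
  obtain ⟨q, hq, hpq⟩ := exists_coefficients_of_mem_idealI' a b c hp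
    (fullSymbol_mem_weightLT_order p)
  rcases lt_or_ge (order p) 2 with h | h
  · have hq0 i : q i = 0 := by
      have := eq_zero_of_mem_weightLT_zero (weightLT_mono (by omega) (hq i))
      simpa using this
    have hp0 : p = 0 := by simp [hpq, hq0]
    simp [hp0, principalSymbol]
  · obtain ⟨r, hr⟩ := Nat.exists_eq_add_of_le' h
    have htop i : HasSymbol r (q i) _ :=
      HasTop.component (weightLT_mono (by omega) (hq i))
    have h1 := HasSymbol.sum fun i (_ : i ∈ Finset.univ) => (htop i).mul (hasSymbol_ell' a b c i)
    rw [← hpq, ← hr] at h1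
    rw [HasTop.unique (hasSymbol_principalSymbol p) h1]
    exact sum_mem fun i _ => Ideal.mul_mem_left _ _ (Ideal.subset_span ⟨i, rfl⟩)

end Weyl

end

theorem mainTheorem4 (m : ℕ) (a b : ℂ) (c : Fin m → ℂ) :
    Weyl.characteristicIdeal (Weyl.idealI' a b c) =
      Ideal.span (Set.range fun i : Fin m => Weyl.principalSymbol (Weyl.ell' a b c i)) := by
  apply le_antisymm
  · rw [Weyl.characteristicIdeal, Ideal.span_le]
    rintro _ ⟨p, hp, rfl⟩
    simp only [Weyl.principalSymbol_ell']
    exact Weyl.principalSymbol_mem_span a b c hp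
  · rw [Ideal.span_le]
    rintro _ ⟨i, rfl⟩
    exact Ideal.subset_span ⟨_, Ideal.subset_span ⟨i, rfl⟩, rfl⟩
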